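/- For a square matrix $A$ over a field $\mathbb F$ and an integer $r\ge 0$ let $$\mathcal R_A(r)=\min_{\operatorname{rank}(A+B)\le r}\operatorname{nnz}(B),\qquad \mathcal R^{rc}_A(r)=\min_{\operatorname{rank}(A+B)\le r}\max\{\operatorname{nnz}_r(B),\operatorname{nnz}_c(B)\},$$ where $B$ ranges over the matrices over $\mathbb F$ of the same size as $A$, and $\operatorname{nnz}(B)$, $\operatorname{nnz}_r(B)$, $\operatorname{nnz}_c(B)$ are the number of nonzero entries of $B$ and the maximum number of nonzero entries in a row, respectively a column, of $B$; for real $r\ge0$ put $\mathcal R_A(r)=\mathcal R_A(\lfloor r\rfloor)$, $\mathcal R^{rc}_A(r)=\mathcal R^{rc}_A(\lfloor r\rfloor)$. For integers $q\ge 2$, $n\ge 0$ and a function $f:\{0,\dots,q-1\}^n\to\mathbb F$ let $V_f\in\mathbb F^{q^n\times q^n}$ be the matrix with entries, for $x,y\in\{0,\dots,q-1\}^n$, $$V_f[x,y]=f(\max\{x_1,y_1\},\dots,\max\{x_n,y_n\}).$$ **Theorem.** 1. There are universal constants $c>0$, $\varepsilon_0>0$ and $K$ such that the following holds. Let $q\ge2$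 and $0<\varepsilon<\varepsilon_0$, and put $$\gamma = c\cdot 2^{-q}\,q\log (q)\cdot\frac{\varepsilon^2}{\log^2(1/\varepsilon)} .$$ For every $n$ such that $N=q^n$ satisfies $N^{\gamma}\ge K$ (that is, for all $n$ beyond an explicit threshold depending only on $q$ and $\varepsilon$), for every field $\mathbb F$ and every $f:\{0,\dots,q-1\}^n\to\mathbb F$, $$\mathcal R^{rc}_{V_f}\bigl(N^{1-\gamma}\bigr)\le N^{\varepsilon}.$$ 2. If $q=q(n)\ge 2$ satisfies $q(n)\le O(\log n)$, then for every field $\mathbb F$ and all functions $f_n:\{0,\dots,q(n)-1\}^n\to\mathbb F$ the family $(V_{f_n})_n$ is not Valiant-rigid. In the strongest form: with $N=q(n)^n$, for all $\varepsilon>0$ and $C>0$ one has $\mathcal R_{V_{f_n}}(C\,N/\log\log N)<N^{1+\varepsilon}$ for all sufficiently large $n$. -/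

import Mathlib

universe u

/-- The number of non-zero entries of a matrix. -/
noncomputable def Matrix.nnz {m n F : Type*} [Zero F] (B : Matrix m n F) : ℕ :=
  {p : m × n | B p.1 p.2 ≠ 0}.ncard

/-- The maximum number of non-zero entries in a row of a matrix. -/
noncomputable def Matrix.nnzRow {m n F : Type*} [Fintype m] [Zero F] (B : Matrix m n F) : ℕ :=
  Finset.univ.sup fun i : m => {j : n | B i j ≠ 0}.ncard

/-- The maximum number of non-zero entries in a column of a matrix. -/
noncomputable def Matrix.nnzCol {m n F : Type*} [Fintype n] [Zero F] (B : Matrix m n F) : ℕ :=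
  Finset.univ.sup fun j : n => {i : m | B i j ≠ 0}.ncard

/-- The rank-`r` rigidity of a square matrix `A`: the least number of entries that have to be
changed to bring the rank down to at most `r`. The set is never empty, since `B = -A` is allowed,
so the infimum is a minimum. -/
noncomputable def Matrix.rigidity {m F : Type*} [Fintype m] [Field F]
    (A : Matrix m m F) (r : ℕ) : ℕ :=
  sInf {s | ∃ B : Matrix m m F, (A + B).rank ≤ r ∧ B.nnz = s}

/-- The rank-`r` row/column rigidity of a square matrix `A`: the least number of entries per row
or column that have to be changed to bring the rank down to at most `r`. -/
noncomputable def Matrix.rcRigidity {m F : Type*} [Fintype m] [Field F]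
    (A : Matrix m m F) (r : ℕ) : ℕ :=
  sInf {s | ∃ B : Matrix m m F, (A + B).rank ≤ r ∧ max B.nnzRow B.nnzCol = s}

/-- The matrix `V_f`, whose rows and columns are indexed by `{0, …, q - 1}ⁿ` and whose `(x, y)`
entry is the value of `f` at the coordinatewise maximum of `x` and `y`. -/
def maxMatrix {n q : ℕ} {F : Type*} (f : (Fin n → Fin q) → F) :
    Matrix (Fin n → Fin q) (Fin n → Fin q) F :=
  Matrix.of fun x y => f fun i => max (x i) (y i)

/-- A sequence of square matrices over a field, the `n`-th one of side length
`N = Fintype.card (ι n)`, is Valiant-rigid if its rank-`O(N / log log N)` rigidity is at least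
`N ^ (1 + ε)` for a fixed `ε > 0`. Both the constant in the `O` and the set of those `n` for which
the bound has to hold are read as leniently as possible (some `C > 0`, infinitely many `n`), so
that failing to be Valiant-rigid is as strong as possible: for all `ε, C > 0` the rigidity is less
than `N ^ (1 + ε)` for all large `n`. -/
def IsValiantRigid {F : Type*} [Field F] {ι : ℕ → Type*} [∀ n, Fintype (ι n)]
    (M : ∀ n, Matrix (ι n) (ι n) F) : Prop :=
  ∃ ε > (0 : ℝ), ∃ C > (0 : ℝ), ∃ᶠ n in Filter.atTop,
    (Fintype.card (ι n) : ℝ) ^ (1 + ε) ≤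
      ((M n).rigidity
        ⌊C * (Fintype.card (ι n) : ℝ) / Real.log (Real.log (Fintype.card (ι n)))⌋₊ : ℝ)

/-! Triangular inversion gives `f w = ∑_{z ≥ w} g z`, and `max x y ≤ z` means `x ≤ z` and `y ≤ z`,
so `V_f = Z D Zᵀ` with `Z` the zeta matrix of the order and `D` the diagonal matrix of `g`. Keeping
only the `z` of high coordinate sum leaves low rank, and the rows and columns indexed by points of
low coordinate sum also cost little rank: by Hoeffding's bound few points deviate from the mean sum
by `n τ`. A remaining entry `(x, y)` is nonzero only if some `z ≥ x, y` has `z - x` and `z - y` of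
coordinate sum at most `2 n τ`. Few vectors have so small a sum, so each row and column keeps few
entries (`exists_rank_add_le_of_sup`, `card_sum_ge_le`, `card_sum_le_le`).

The deviation `τ` is of order `ε / log (1/ε)`. The rank saving is `exp (-2 n τ² / q²)`, only
polynomial in `q` in the exponent, which covers both the factor `2 ^ (-q)` in `γ` and the range `q =
O(log n)`. -/

/-- On a finite partial order every function is the sum, over upper sets, of some function. -/
theorem exists_sum_ge_eq {α F : Type*} [Fintype α] [PartialOrder α] [DecidableLE α] [Field F]
    (f : α → F) : ∃ g : α → F, ∀ w, f w = ∑ z, if w ≤ z then g z else 0 := by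
  let T : (α → F) →ₗ[F] (α → F) :=
    { toFun := fun g w => ∑ z, if w ≤ z then g z else 0
      map_add' := fun g h => by
        ext w
        simp only [Pi.add_apply, ← Finset.sum_add_distrib]
        exact Finset.sum_congr rfl fun z _ => by split_ifs <;> simp
      map_smul' := fun c g => by
        ext w
        simp [Finset.mul_sum] }
  have hinj : Function.Injective T := by
    rw [injective_iff_map_eq_zero]
    intro g hg
    have key : ∀ w, g w = 0 := by
      intro w
      -- Downward induction: once `g` vanishes strictly above `w`, only the diagonal term `g w`
      -- survives.
      induction w using (wellFounded_gt (α := α)).induction with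
      | _ w ih =>
        have h : ∑ z, (if w ≤ z then g z else 0) = 0 := congrFun hg w
        rwa [Finset.sum_eq_single w, if_pos le_rfl] at h
        · intro z _ hz
          split_ifs with hwz
          · exact ih z (lt_of_le_of_ne hwz hz.symm)
          · rfl
        · simp
    exact funext key
  obtain ⟨g, hg⟩ := (LinearMap.injective_iff_surjective.mp hinj) f
  exact ⟨g, fun w => (congrFun hg w).symm⟩

/-! ### Elementary rank bounds -/

theorem Matrix.rank_add_le_add {m n F : Type*} [Fintype m] [Fintype n] [Field F]
    (A B : Matrix m n F) : (A + B).rank ≤ A.rank + B.rank := by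
  rw [Matrix.rank, Matrix.rank, Matrix.rank, Matrix.mulVecLin_add]
  exact (Submodule.finrank_mono (LinearMap.range_add_le _ _)).trans
    (Submodule.finrank_add_le_finrank_add_finrank _ _)

theorem Matrix.rank_diagonal_le_card {m F : Type*} [Fintype m] [DecidableEq m] [Field F]
    (w : m → F) (S : Finset m) (h : ∀ i ∉ S, w i = 0) : (Matrix.diagonal w).rank ≤ S.card := by
  classical
  rw [Matrix.rank_diagonal, Fintype.card_subtype]
  refine Finset.card_le_card fun i hi => ?_
  by_contra hS
  exact (Finset.mem_filter.mp hi).2 (h i hS)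

theorem Matrix.rank_le_card_rows {m n F : Type*} [Fintype m] [Fintype n] [Field F]
    (A : Matrix m n F) (S : Finset m) (h : ∀ i ∉ S, ∀ j, A i j = 0) : A.rank ≤ S.card := by
  classical
  have hA : A = Matrix.diagonal (fun i => if i ∈ S then (1 : F) else 0) * A := by
    ext i j
    rw [Matrix.diagonal_mul]
    by_cases hi : i ∈ S
    · simp [hi]
    · simp [hi, h i hi j]
  rw [hA]
  exact (Matrix.rank_mul_le_left _ _).trans
    (Matrix.rank_diagonal_le_card _ S fun i hi => if_neg hi)

theorem Matrix.rank_le_card_cols {m n F : Type*} [Fintype m] [Fintype n] [Field F]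
    (A : Matrix m n F) (S : Finset n) (h : ∀ j ∉ S, ∀ i, A i j = 0) : A.rank ≤ S.card := by
  rw [← Matrix.rank_transpose]
  exact Matrix.rank_le_card_rows _ S fun j hj i => h j hj i

/-! ### Join matrices as low rank plus sparse -/

/-- Up to a matrix of rank at most `2 |L| + |H|`, a join matrix is supported on the pairs of
elements outside `L` that have a common upper bound outside `H`. -/
theorem exists_rank_add_le_of_sup {α F : Type*} [Fintype α] [SemilatticeSup α] [Field F]
    (f : α → F) (L H : Finset α) :
    ∃ B : Matrix α α F, (Matrix.of (fun x y => f (x ⊔ y)) + B).rank ≤ 2 * L.card + H.card ∧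
      ∀ x y, B x y ≠ 0 → x ∉ L ∧ y ∉ L ∧ ∃ z ∉ H, x ≤ z ∧ y ≤ z := by
  classical
  obtain ⟨g, hg⟩ := exists_sum_ge_eq f
  let Z : Matrix α α F := Matrix.of fun x z => if x ≤ z then 1 else 0
  let P : (α → F) → Matrix α α F := fun w => Z * Matrix.diagonal w * Z.transpose
  have hP : ∀ w x y, P w x y = ∑ z, if x ≤ z ∧ y ≤ z then w z else 0 := by
    intro w x y
    change (Z * Matrix.diagonal w * Z.transpose) x y = _
    rw [Matrix.mul_apply]
    simp only [Matrix.mul_diagonal, Matrix.transpose_apply, Z, Matrix.of_apply]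
    refine Finset.sum_congr rfl fun z _ => ?_
    by_cases h1 : x ≤ z <;> by_cases h2 : y ≤ z <;> simp [h1, h2]
  let w₁ : α → F := fun z => if z ∈ H then g z else 0
  let w₂ : α → F := fun z => if z ∈ H then 0 else g z
  -- The low part is cut into rows in `L`, the remaining columns in `L`, and the rest, which `B`
  -- cancels.
  let R : Matrix α α F := Matrix.of fun x y => if x ∈ L then P w₂ x y else 0
  let C : Matrix α α F := Matrix.of fun x y => if x ∉ L ∧ y ∈ L then P w₂ x y else 0
  let B : Matrix α α F := Matrix.of fun x y => if x ∉ L ∧ y ∉ L then -P w₂ x y else 0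
  have hsum : Matrix.of (fun x y => f (x ⊔ y)) + B = P w₁ + (R + C) := by
    ext x y
    have h1 : f (x ⊔ y) = P w₁ x y + P w₂ x y := by
      rw [hg, hP, hP, ← Finset.sum_add_distrib]
      refine Finset.sum_congr rfl fun z _ => ?_
      simp only [sup_le_iff, w₁, w₂]
      split_ifs <;> simp
    simp only [Matrix.add_apply, Matrix.of_apply, B, R, C, h1]
    by_cases hx : x ∈ L <;> by_cases hy : y ∈ L <;> simp [hx, hy]
  refine ⟨B, ?_, ?_⟩
  · rw [hsum]
    have h1 : (P w₁).rank ≤ H.card :=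
      (Matrix.rank_mul_le_left _ _).trans ((Matrix.rank_mul_le_right _ _).trans
        (Matrix.rank_diagonal_le_card _ H fun z hz => if_neg hz))
    have h2 : R.rank ≤ L.card := Matrix.rank_le_card_rows _ L fun i hi j => by simp [R, hi]
    have h3 : C.rank ≤ L.card := Matrix.rank_le_card_cols _ L fun i hi j => by simp [C, hi]
    have h4 := Matrix.rank_add_le_add (P w₁) (R + C)
    have h5 := Matrix.rank_add_le_add R C
    omega
  · intro x y hxy
    simp only [B, Matrix.of_apply] at hxy
    split_ifs at hxy with hL
    · refine ⟨hL.1, hL.2, ?_⟩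
      rw [neg_ne_zero, hP] at hxy
      obtain ⟨z, -, hz⟩ := Finset.exists_ne_zero_of_sum_ne_zero hxy
      split_ifs at hz with hle
      · refine ⟨z, fun hzH => ?_, hle⟩
        simp [w₂, hzH] at hz
      · exact absurd rfl hz
    · exact absurd rfl hxy

/-! ### Tail counts on a box by exponential moments -/

/-- The sum of a product function over a box factors. -/
theorem sum_pi_prod_eq_pow (n q : ℕ) (h : Fin q → ℝ) :
    ∑ x : Fin n → Fin q, ∏ i, h (x i) = (∑ a, h a) ^ n := by
  rw [← Fintype.piFinset_univ, Finset.sum_prod_piFinset]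
  simp

/-- Hoeffding's lemma for the uniform law: reflection symmetry turns `exp` into `cosh`, then `cosh t
≤ exp (t² / 2)` and the centred values are at most `q / 2` in size. -/
theorem sum_exp_centered_le (q : ℕ) (l : ℝ) :
    ∑ a : Fin q, Real.exp (l * ((a : ℝ) - ((q : ℝ) - 1) / 2)) ≤
      q * Real.exp (l ^ 2 * q ^ 2 / 8) := by
  have hrev : ∑ a : Fin q, Real.exp (l * ((a : ℝ) - ((q : ℝ) - 1) / 2)) =
      ∑ a : Fin q, Real.exp (-(l * ((a : ℝ) - ((q : ℝ) - 1) / 2))) := by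
    rw [← Equiv.sum_comp Fin.revPerm]
    refine Finset.sum_congr rfl fun a _ => ?_
    have : ((Fin.rev a : Fin q) : ℝ) = q - (a + 1) := by
      rw [Fin.val_rev, Nat.cast_sub a.2]; push_cast; ring
    rw [Fin.revPerm_apply, this]
    congr 1; ring
  have hcosh : ∑ a : Fin q, Real.exp (l * ((a : ℝ) - ((q : ℝ) - 1) / 2)) =
      ∑ a : Fin q, Real.cosh (l * ((a : ℝ) - ((q : ℝ) - 1) / 2)) := by
    simp only [Real.cosh_eq, ← Finset.sum_div, Finset.sum_add_distrib]
    rw [← hrev]; ring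
  rw [hcosh]
  refine (Finset.sum_le_card_nsmul _ _ (Real.exp (l ^ 2 * q ^ 2 / 8)) fun a _ => ?_).trans
    (by simp)
  refine (Real.cosh_le_exp_half_sq _).trans (Real.exp_le_exp.mpr ?_)
  have ha : ((a : ℝ) - ((q : ℝ) - 1) / 2) ^ 2 ≤ (q / 2) ^ 2 := by
    have h1 : (a : ℝ) + 1 ≤ q := by exact_mod_cast a.2
    have h0 : (0 : ℝ) ≤ a := by positivity
    apply sq_le_sq'  <;> linarith
  rw [mul_pow]
  nlinarith [mul_le_mul_of_nonneg_left ha (sq_nonneg l)]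

/-- Chernoff's bound for the upper tail of the coordinate sum on a box. -/
theorem card_sum_ge_le (n q : ℕ) (hq : 0 < q) (τ : ℝ) (hτ : 0 ≤ τ) (S : Finset (Fin n → Fin q))
    (hS : ∀ x ∈ S, n * τ ≤ ∑ i, ((x i : ℝ) - ((q : ℝ) - 1) / 2)) :
    (S.card : ℝ) ≤ q ^ n * Real.exp (-(2 * n * τ ^ 2 / q ^ 2)) := by
  have hq' : (q : ℝ) ≠ 0 := by positivity
  -- This `l` minimises `l² q² / 8 - l τ`.
  set l : ℝ := 4 * τ / q ^ 2 with hl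
  have hl0 : 0 ≤ l := by positivity
  have h1 : (S.card : ℝ) * Real.exp (l * (n * τ)) ≤ (q * Real.exp (l ^ 2 * q ^ 2 / 8)) ^ n := by
    calc (S.card : ℝ) * Real.exp (l * (n * τ))
        ≤ ∑ x ∈ S, ∏ i, Real.exp (l * ((x i : ℝ) - ((q : ℝ) - 1) / 2)) := by
          rw [← nsmul_eq_mul]
          refine Finset.card_nsmul_le_sum _ _ _ fun x hx => ?_
          rw [← Real.exp_sum, ← Finset.mul_sum]
          exact Real.exp_le_exp.mpr (mul_le_mul_of_nonneg_left (hS x hx) hl0)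
      _ ≤ ∑ x : Fin n → Fin q, ∏ i, Real.exp (l * ((x i : ℝ) - ((q : ℝ) - 1) / 2)) :=
          Finset.sum_le_sum_of_subset_of_nonneg (Finset.subset_univ _)
            fun _ _ _ => Finset.prod_nonneg fun _ _ => (Real.exp_pos _).le
      _ = (∑ a : Fin q, Real.exp (l * ((a : ℝ) - ((q : ℝ) - 1) / 2))) ^ n :=
          sum_pi_prod_eq_pow n q fun a => Real.exp (l * ((a : ℝ) - ((q : ℝ) - 1) / 2))
      _ ≤ _ := pow_le_pow_left₀ (Finset.sum_nonneg fun _ _ => (Real.exp_pos _).le)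
          (sum_exp_centered_le q l) n
  have h2 : -(2 * n * τ ^ 2 / (q : ℝ) ^ 2) = n * (l ^ 2 * q ^ 2 / 8) - l * (n * τ) := by
    rw [hl]; field_simp; ring
  rw [h2, Real.exp_sub, ← mul_div_assoc, le_div_iff₀ (Real.exp_pos _), Real.exp_nat_mul,
    ← mul_pow]
  exact h1

/-- Few points of a box have a small coordinate sum. -/
theorem card_sum_le_le (n q : ℕ) (θ t : ℝ) (hθ : 0 < θ) (hθ' : θ ≤ 1 / 2)
    (S : Finset (Fin n → Fin q)) (hS : ∀ x ∈ S, ∑ i, (x i : ℝ) ≤ t) :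
    (S.card : ℝ) ≤ Real.exp (t * Real.log (1 / θ) + 2 * θ * n) := by
  have hlog : 0 ≤ Real.log (1 / θ) :=
    Real.log_nonneg (by rw [le_div_iff₀ hθ]; linarith)
  have hpow : ∀ k : ℕ, θ ^ k = Real.exp (-(Real.log (1 / θ) * k)) := fun k => by
    rw [one_div, Real.log_inv, neg_mul, neg_neg, mul_comm, Real.exp_nat_mul, Real.exp_log hθ]
  -- Comparison with the full geometric series makes the bound independent of `q`; `θ ≤ 1/2` gives
  -- `1 / (1 - θ) ≤ 1 + 2 θ`.
  have hgeom : ∑ a : Fin q, θ ^ (a : ℕ) ≤ Real.exp (2 * θ) := by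
    rw [Fin.sum_univ_eq_sum_range fun k => θ ^ k]
    have h1 : ∑ i ∈ Finset.range q, θ ^ i ≤ (1 - θ)⁻¹ := by
      rw [← tsum_geometric_of_lt_one hθ.le (by linarith)]
      exact (summable_geometric_of_lt_one hθ.le (by linarith)).sum_le_tsum _
        fun i _ => by positivity
    refine h1.trans (le_trans ?_ (Real.add_one_le_exp _))
    rw [inv_le_iff_one_le_mul₀ (by linarith)]
    nlinarith
  have h1 : (S.card : ℝ) * Real.exp (-(Real.log (1 / θ) * t)) ≤ Real.exp (2 * θ) ^ n := by
    calc (S.card : ℝ) * Real.exp (-(Real.log (1 / θ) * t))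
        ≤ ∑ x ∈ S, ∏ i, θ ^ (x i : ℕ) := by
          rw [← nsmul_eq_mul]
          refine Finset.card_nsmul_le_sum _ _ _ fun x hx => ?_
          rw [Finset.prod_pow_eq_pow_sum, hpow]
          push_cast
          exact Real.exp_le_exp.mpr (neg_le_neg (mul_le_mul_of_nonneg_left (hS x hx) hlog))
      _ ≤ ∑ x : Fin n → Fin q, ∏ i, θ ^ (x i : ℕ) :=
          Finset.sum_le_sum_of_subset_of_nonneg (Finset.subset_univ _)
            fun _ _ _ => Finset.prod_nonneg fun _ _ => by positivity
      _ = (∑ a : Fin q, θ ^ (a : ℕ)) ^ n := sum_pi_prod_eq_pow n q fun a => θ ^ (a : ℕ)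
      _ ≤ _ := pow_le_pow_left₀ (Finset.sum_nonneg fun _ _ => by positivity) hgeom n
  have h2 : t * Real.log (1 / θ) + 2 * θ * n = n * (2 * θ) - -(Real.log (1 / θ) * t) := by ring
  rw [h2, Real.exp_sub, le_div_iff₀ (Real.exp_pos _), Real.exp_nat_mul]
  exact h1

/-! ### Sparsity counts and the decomposition of max matrices -/

theorem Matrix.nnzRow_le {m n F : Type*} [Fintype m] [Zero F] (B : Matrix m n F) (c : ℝ)
    (hc : 0 ≤ c) (h : ∀ i, ({j : n | B i j ≠ 0}.ncard : ℝ) ≤ c) : (B.nnzRow : ℝ) ≤ c :=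
  (Nat.le_floor_iff hc).mp (Finset.sup_le fun i _ => Nat.le_floor (h i))

theorem Matrix.nnzCol_le {m n F : Type*} [Fintype n] [Zero F] (B : Matrix m n F) (c : ℝ)
    (hc : 0 ≤ c) (h : ∀ j, ({i : m | B i j ≠ 0}.ncard : ℝ) ≤ c) : (B.nnzCol : ℝ) ≤ c :=
  (Nat.le_floor_iff hc).mp (Finset.sup_le fun i _ => Nat.le_floor (h i))

theorem Matrix.nnz_le_card_mul_nnzRow {m n F : Type*} [Fintype m] [Finite n] [Zero F]
    (B : Matrix m n F) : B.nnz ≤ Fintype.card m * B.nnzRow := by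
  classical
  have hset : {p : m × n | B p.1 p.2 ≠ 0} =
      ⋃ i ∈ (Finset.univ : Finset m), Prod.mk i '' {j | B i j ≠ 0} := by
    ext ⟨i, j⟩
    simp
  rw [Matrix.nnz, hset]
  refine (Finset.set_ncard_biUnion_le _ _).trans
    ((Finset.sum_le_card_nsmul _ _ B.nnzRow fun i hi => ?_).trans (by simp))
  refine (Set.ncard_image_le (Set.toFinite _)).trans ?_
  exact Finset.le_sup (f := fun i : m => {j : n | B i j ≠ 0}.ncard) hi

theorem Fin.sum_val_pi_sub {n q : ℕ} {x z : Fin n → Fin q} (h : x ≤ z) :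
    ∑ i, (((z - x) i : Fin q) : ℝ) = ∑ i, ((z i : ℝ) - x i) := by
  refine Finset.sum_congr rfl fun i _ => ?_
  rw [Pi.sub_apply, Fin.sub_val_of_le (h i), Nat.cast_sub (h i)]

/-- A max matrix is the sum of a matrix of low rank and a sparse matrix. -/
theorem exists_rank_maxMatrix_add_le {n q : ℕ} (hq : 0 < q) {F : Type*} [Field F]
    (f : (Fin n → Fin q) → F) (τ θ : ℝ) (hτ : 0 ≤ τ) (hθ : 0 < θ) (hθ' : θ ≤ 1 / 2) :
    ∃ B : Matrix (Fin n → Fin q) (Fin n → Fin q) F,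
      ((maxMatrix f + B).rank : ℝ) ≤ 3 * (q ^ n * Real.exp (-(2 * n * τ ^ 2 / q ^ 2))) ∧
      (max B.nnzRow B.nnzCol : ℝ) ≤
        Real.exp (2 * (2 * n * τ * Real.log (1 / θ) + 2 * θ * n)) := by
  classical
  have : NeZero q := ⟨hq.ne'⟩
  let s : (Fin n → Fin q) → ℝ := fun x => ∑ i, ((x i : ℝ) - ((q : ℝ) - 1) / 2)
  let H : Finset (Fin n → Fin q) := Finset.univ.filter fun x => n * τ ≤ s x
  let L : Finset (Fin n → Fin q) := Finset.univ.filter fun x => n * τ ≤ -s x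
  obtain ⟨B, hB, hB'⟩ := exists_rank_add_le_of_sup f L H
  have hH : (H.card : ℝ) ≤ q ^ n * Real.exp (-(2 * n * τ ^ 2 / q ^ 2)) :=
    card_sum_ge_le n q hq τ hτ H fun x hx => (Finset.mem_filter.mp hx).2
  have hL : (L.card : ℝ) ≤ q ^ n * Real.exp (-(2 * n * τ ^ 2 / q ^ 2)) := by
    -- Reversing every coordinate carries the lower tail to the upper one.
    have hinj : Function.Injective fun (x : Fin n → Fin q) i => Fin.rev (x i) := fun x y h =>
      funext fun i => Fin.rev_injective (congrFun h i)
    rw [← Finset.card_image_of_injective L hinj]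
    refine card_sum_ge_le n q hq τ hτ _ fun x hx => ?_
    obtain ⟨y, hy, rfl⟩ := Finset.mem_image.mp hx
    refine (Finset.mem_filter.mp hy).2.trans_eq ?_
    rw [← Finset.sum_neg_distrib]
    refine Finset.sum_congr rfl fun i _ => ?_
    rw [Fin.val_rev, Nat.cast_sub (y i).2]
    push_cast
    ring
  set M : ℝ := Real.exp (2 * n * τ * Real.log (1 / θ) + 2 * θ * n) with hM
  have hclose : ∀ x z, x ∉ L → z ∉ H → x ≤ z → ∑ i, (((z - x) i : Fin q) : ℝ) ≤ 2 * n * τ := by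
    intro x z hx hz hxz
    have hx' : -s x < n * τ := by simpa [L] using hx
    have hz' : s z < n * τ := by simpa [H] using hz
    have : ∑ i, ((z i : ℝ) - x i) = s z - s x := by
      rw [← Finset.sum_sub_distrib]
      exact Finset.sum_congr rfl fun i _ => by ring
    rw [Fin.sum_val_pi_sub hxz, this]
    linarith
  -- Subtraction is modulo `q`, so these sets may contain points not comparable with the base point.
  -- This only enlarges them, and makes translation and reflection injective into the small-sum
  -- vectors.
  let U : (Fin n → Fin q) → Finset (Fin n → Fin q) := fun x =>
    Finset.univ.filter fun z => ∑ i, (((z - x) i : Fin q) : ℝ) ≤ 2 * n * τ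
  let D : (Fin n → Fin q) → Finset (Fin n → Fin q) := fun z =>
    Finset.univ.filter fun x => ∑ i, (((z - x) i : Fin q) : ℝ) ≤ 2 * n * τ
  have hU : ∀ x, ((U x).card : ℝ) ≤ M := fun x => by
    rw [← Finset.card_image_of_injective (U x) (sub_left_injective (b := x))]
    refine card_sum_le_le n q θ _ hθ hθ' _ fun y hy => ?_
    obtain ⟨z, hz, rfl⟩ := Finset.mem_image.mp hy
    exact (Finset.mem_filter.mp hz).2
  have hD : ∀ z, ((D z).card : ℝ) ≤ M := fun z => by
    rw [← Finset.card_image_of_injective (D z) (sub_right_injective (b := z))]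
    refine card_sum_le_le n q θ _ hθ hθ' _ fun y hy => ?_
    obtain ⟨x, hx, rfl⟩ := Finset.mem_image.mp hy
    exact (Finset.mem_filter.mp hx).2
  have hUD : ∀ x, ((((U x).biUnion D).card : ℕ) : ℝ) ≤ M * M := fun x => by
    calc ((((U x).biUnion D).card : ℕ) : ℝ) ≤ ∑ z ∈ U x, ((D z).card : ℝ) := by
          exact_mod_cast Finset.card_biUnion_le
      _ ≤ (U x).card * M := by
          rw [← nsmul_eq_mul]
          exact Finset.sum_le_card_nsmul _ _ _ fun z _ => hD z
      _ ≤ M * M := mul_le_mul_of_nonneg_right (hU x) (Real.exp_pos _).le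
  have hMM : Real.exp (2 * (2 * n * τ * Real.log (1 / θ) + 2 * θ * n)) = M * M := by
    rw [hM, ← Real.exp_add, two_mul]
  have hmem : ∀ x y, B x y ≠ 0 → y ∈ (U x).biUnion D ∧ x ∈ (U y).biUnion D := by
    intro x y hxy
    obtain ⟨hx, hy, z, hz, hxz, hyz⟩ := hB' x y hxy
    have h1 := hclose x z hx hz hxz
    have h2 := hclose y z hy hz hyz
    exact ⟨Finset.mem_biUnion.mpr ⟨z, Finset.mem_filter.mpr ⟨Finset.mem_univ _, h1⟩,
      Finset.mem_filter.mpr ⟨Finset.mem_univ _, h2⟩⟩,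
      Finset.mem_biUnion.mpr ⟨z, Finset.mem_filter.mpr ⟨Finset.mem_univ _, h2⟩,
      Finset.mem_filter.mpr ⟨Finset.mem_univ _, h1⟩⟩⟩
  have hMM0 : 0 ≤ M * M := by positivity
  have hset : ∀ x, ∀ T : Set (Fin n → Fin q), T ⊆ ((U x).biUnion D : Finset _) →
      (T.ncard : ℝ) ≤ M * M := fun x T hT => by
    refine le_trans ?_ (hUD x)
    rw [← Set.ncard_coe_finset]
    exact_mod_cast Set.ncard_le_ncard hT (Finset.finite_toSet _)
  refine ⟨B, ?_, ?_⟩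
  · have h : ((maxMatrix f + B).rank : ℝ) ≤ 2 * L.card + H.card := by exact_mod_cast hB
    linarith
  · rw [hMM]
    exact max_le (B.nnzRow_le _ hMM0 fun x => hset x _ fun y hy => (hmem x y hy).1)
      (B.nnzCol_le _ hMM0 fun y => hset y _ fun x hx => (hmem x y hx).2)

/-- The sparsity bound becomes a power of the side length for a suitable choice of parameters. -/
theorem exists_rank_maxMatrix_add_le_of_lt {n q : ℕ} (hq : 2 ≤ q) {F : Type*} [Field F]
    (f : (Fin n → Fin q) → F) (ε : ℝ) (hε : 0 < ε) (hε' : ε < 1 / 16) :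
    ∃ B : Matrix (Fin n → Fin q) (Fin n → Fin q) F,
      ((maxMatrix f + B).rank : ℝ) ≤
        3 * (q ^ n * Real.exp (-(2 * n * (ε / (32 * Real.log (1 / ε))) ^ 2 / q ^ 2))) ∧
      (max B.nnzRow B.nnzCol : ℝ) ≤ ((q : ℝ) ^ n) ^ ε := by
  have hlog : 0 < Real.log (1 / ε) := Real.log_pos (by rw [lt_div_iff₀ hε]; linarith)
  obtain ⟨B, hB, hB'⟩ := exists_rank_maxMatrix_add_le (by omega : 0 < q) f
    (ε / (32 * Real.log (1 / ε))) (ε / 16) (by positivity) (by positivity) (by linarith)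
  refine ⟨B, hB, hB'.trans ?_⟩
  have hq' : (2 : ℝ) ≤ q := by exact_mod_cast hq
  have hlogq : 1 / 2 ≤ Real.log q := by
    have := Real.log_two_gt_d9
    have := Real.log_le_log two_pos hq'
    linarith
  -- This is `16 ≤ 1/ε`. Both terms of the sparsity exponent then add up to at most `n ε / 2`, which
  -- is at most `n ε log q`.
  have h16 : Real.log (1 / (ε / 16)) ≤ 2 * Real.log (1 / ε) := by
    rw [two_mul, ← Real.log_mul (by positivity) (by positivity)]
    refine Real.log_le_log (by positivity) ?_
    rw [div_mul_div_comm, div_le_div_iff₀ (by positivity) (by positivity)]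
    nlinarith
  have hτ : ε / (32 * Real.log (1 / ε)) * Real.log (1 / (ε / 16)) ≤ ε / 16 := by
    calc _ ≤ ε / (32 * Real.log (1 / ε)) * (2 * Real.log (1 / ε)) :=
          mul_le_mul_of_nonneg_left h16 (by positivity)
      _ = ε / 16 := by field_simp; norm_num
  rw [← Real.rpow_natCast, ← Real.rpow_mul (by positivity), Real.rpow_def_of_pos (by positivity)]
  refine Real.exp_le_exp.mpr ?_
  have hn : (0 : ℝ) ≤ n := n.cast_nonneg
  have h1 := mul_le_mul_of_nonneg_left hτ hn
  have h2 := mul_le_mul_of_nonneg_right hlogq (mul_nonneg hn hε.le)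
  linarith

/-! ### Rigidity bounds -/

theorem Matrix.rcRigidity_le {m F : Type*} [Fintype m] [Field F] {A B : Matrix m m F} {r : ℕ}
    (h : (A + B).rank ≤ r) : A.rcRigidity r ≤ max B.nnzRow B.nnzCol :=
  Nat.sInf_le ⟨B, h, rfl⟩

theorem Matrix.rigidity_le {m F : Type*} [Fintype m] [Field F] {A B : Matrix m m F} {r : ℕ}
    (h : (A + B).rank ≤ r) : A.rigidity r ≤ B.nnz :=
  Nat.sInf_le ⟨B, h, rfl⟩

/-- From `t⁵ / 5! ≤ exp t` at `t = q log 2 ≥ q / 2`, with `3840 = 5! · 2⁵`. It trades the polynomial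
loss in `q` for the factor `2 ^ (-q)` in `γ`. -/
theorem pow_five_le_two_pow (q : ℕ) : (q : ℝ) ^ 5 ≤ 3840 * 2 ^ q := by
  have h := Real.pow_div_factorial_le_exp (x := q * Real.log 2) (by positivity) 5
  rw [Real.exp_nat_mul, Real.exp_log two_pos, div_le_iff₀ (by positivity)] at h
  have h2 : (q : ℝ) * (1 / 2) ≤ q * Real.log 2 :=
    mul_le_mul_of_nonneg_left (by linarith [Real.log_two_gt_d9]) q.cast_nonneg
  have h3 := pow_le_pow_left₀ (by positivity) h2 5
  have h4 : ((Nat.factorial 5 : ℕ) : ℝ) = 120 := by norm_num [Nat.factorial]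
  rw [h4] at h
  rw [mul_pow] at h3
  linarith

theorem rcRigidity_maxMatrix_le {q : ℕ} (hq : 2 ≤ q) {ε : ℝ} (hε : 0 < ε) (hε' : ε < 1 / 16)
    {γ : ℝ} (hγ : γ = 1 / (1024 * 3840) *
      ((q : ℝ) * Real.log q / 2 ^ q * (ε ^ 2 / Real.log (1 / ε) ^ 2)))
    {n : ℕ} (hn : 3 ≤ ((q : ℝ) ^ n) ^ γ) {F : Type*} [Field F] (f : (Fin n → Fin q) → F) :
    ((maxMatrix f).rcRigidity ⌊((q : ℝ) ^ n) ^ (1 - γ)⌋₊ : ℝ) ≤ ((q : ℝ) ^ n) ^ ε := by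
  obtain ⟨B, hB, hB'⟩ := exists_rank_maxMatrix_add_le_of_lt hq f ε hε hε'
  have hq' : (2 : ℝ) ≤ q := by exact_mod_cast hq
  have hlog : 0 < Real.log (1 / ε) := Real.log_pos (by rw [lt_div_iff₀ hε]; linarith)
  have hlogq : 0 < Real.log q := Real.log_pos (by linarith)
  have hqn : (0 : ℝ) < (q : ℝ) ^ n := by positivity
  -- After cancelling `1024 = 32²` this is `q³ (log q)² ≤ 3840 · 2 ^ q`, which follows from `log q ≤
  -- q`.
  have hγq : Real.log q * γ ≤ (ε / (32 * Real.log (1 / ε))) ^ 2 / q ^ 2 := by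
    have h1 : (ε / (32 * Real.log (1 / ε))) ^ 2 / (q : ℝ) ^ 2 =
        ε ^ 2 / Real.log (1 / ε) ^ 2 * (1 / (1024 * q ^ 2)) := by
      field_simp; norm_num
    have h2 : Real.log q * γ = ε ^ 2 / Real.log (1 / ε) ^ 2 *
        ((q : ℝ) * Real.log q ^ 2 / (1024 * 3840 * 2 ^ q)) := by
      rw [hγ]; field_simp
    rw [h1, h2]
    refine mul_le_mul_of_nonneg_left ?_ (by positivity)
    rw [div_le_div_iff₀ (by positivity) (by positivity)]
    have h3 : Real.log q ^ 2 ≤ (q : ℝ) ^ 2 :=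
      pow_le_pow_left₀ hlogq.le (Real.log_le_self (by linarith)) 2
    have h4 := mul_le_mul_of_nonneg_left h3 (by positivity : (0 : ℝ) ≤ q ^ 3)
    have h5 := pow_five_le_two_pow q
    nlinarith
  have hrank : (maxMatrix f + B).rank ≤ ⌊((q : ℝ) ^ n) ^ (1 - γ)⌋₊ := by
    refine Nat.le_floor (hB.trans ?_)
    have h1 : ((q : ℝ) ^ n) ^ (1 - γ) = q ^ n * (((q : ℝ) ^ n) ^ γ)⁻¹ := by
      rw [Real.rpow_sub hqn, Real.rpow_one, div_eq_mul_inv]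
    -- The factor `2` in Hoeffding's exponent yields `N ^ (-γ)` twice: one copy is the rank saving,
    -- the other absorbs the factor `3`.
    have h2 : Real.exp (-(2 * n * (ε / (32 * Real.log (1 / ε))) ^ 2 / (q : ℝ) ^ 2)) ≤
        (((q : ℝ) ^ n) ^ γ)⁻¹ * (((q : ℝ) ^ n) ^ γ)⁻¹ := by
      rw [Real.rpow_def_of_pos hqn, ← Real.exp_neg, ← Real.exp_add, Real.log_pow]
      refine Real.exp_le_exp.mpr ?_
      have := mul_le_mul_of_nonneg_left hγq n.cast_nonneg
      rw [mul_div_assoc]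
      nlinarith
    have h3 : 3 * (((q : ℝ) ^ n) ^ γ)⁻¹ ≤ 1 := by
      rw [← div_eq_mul_inv, div_le_one (by linarith)]
      exact hn
    have h4 : 0 < (((q : ℝ) ^ n) ^ γ)⁻¹ := by positivity
    calc 3 * ((q : ℝ) ^ n * Real.exp (-(2 * n * (ε / (32 * Real.log (1 / ε))) ^ 2 / q ^ 2)))
        ≤ 3 * ((q : ℝ) ^ n * ((((q : ℝ) ^ n) ^ γ)⁻¹ * (((q : ℝ) ^ n) ^ γ)⁻¹)) := by gcongr
      _ = (q : ℝ) ^ n * (((q : ℝ) ^ n) ^ γ)⁻¹ * (3 * (((q : ℝ) ^ n) ^ γ)⁻¹) := by ring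
      _ ≤ (q : ℝ) ^ n * (((q : ℝ) ^ n) ^ γ)⁻¹ * 1 := by gcongr
      _ = _ := by rw [h1, mul_one]
  refine le_trans ?_ hB'
  exact_mod_cast Matrix.rcRigidity_le hrank

theorem eventually_const_mul_log_pow_le (a : ℝ) {b : ℝ} (hb : 0 < b) (k : ℕ) :
    ∀ᶠ n : ℕ in Filter.atTop, a * Real.log n ^ k ≤ b * n := by
  have h := ((Real.isLittleO_pow_log_id_atTop (n := k)).comp_tendsto
    tendsto_natCast_atTop_atTop).const_mul_left a
  filter_upwards [h.bound hb] with n hn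
  simp only [Function.comp_apply, id_eq, Real.norm_eq_abs, Nat.abs_cast] at hn
  exact (le_abs_self _).trans hn

theorem not_isValiantRigid_maxMatrix {F : Type*} [Field F] {q : ℕ → ℕ} (hq : ∀ n, 2 ≤ q n)
    (hO : (fun n => (q n : ℝ)) =O[Filter.atTop] (fun n : ℕ => Real.log n))
    (f : ∀ n, (Fin n → Fin (q n)) → F) : ¬ IsValiantRigid fun n => maxMatrix (f n) := by
  rintro ⟨ε, hε, C, hC, hfreq⟩
  refine hfreq ?_
  obtain ⟨A, hA, hqA⟩ := hO.exists_pos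
  -- Strictly below `ε`, for the strict final inequality, and below the threshold `1/16`.
  set ε' : ℝ := min (ε / 2) (1 / 32) with hε'
  have hε0 : 0 < ε' := lt_min (by linarith) (by norm_num)
  have hε1 : ε' < 1 / 16 := (min_le_right _ _).trans_lt (by norm_num)
  have hε2 : ε' < ε := (min_le_left _ _).trans_lt (by linarith)
  set τ : ℝ := ε' / (32 * Real.log (1 / ε')) with hτ
  have hτ0 : 0 < τ := by
    have : 0 < Real.log (1 / ε') := Real.log_pos (by rw [lt_div_iff₀ hε0]; linarith)
    positivity
  filter_upwards [hqA.bound, eventually_const_mul_log_pow_le A one_pos 1,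
    eventually_const_mul_log_pow_le (3 * A ^ 2) (by positivity : 0 < C * τ ^ 2) 3,
    Filter.eventually_ge_atTop 3] with n hn1 hn2 hn3 hn4
  obtain ⟨B, hB, hB'⟩ := exists_rank_maxMatrix_add_le_of_lt (hq n) (f n) ε' hε0 hε1
  rw [← hτ] at hB
  have hcard : (Fintype.card (Fin n → Fin (q n)) : ℝ) = (q n : ℝ) ^ n := by simp
  rw [hcard, not_le]
  have hq' : (2 : ℝ) ≤ q n := by exact_mod_cast hq n
  have hn : (3 : ℝ) ≤ n := by exact_mod_cast hn4
  have hlogn : 0 < Real.log n := Real.log_pos (by linarith)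
  rw [Real.norm_of_nonneg (by positivity), Real.norm_of_nonneg hlogn.le] at hn1
  rw [pow_one, one_mul] at hn2
  have hN : (1 : ℝ) < (q n : ℝ) ^ n := one_lt_pow₀ (by linarith) (by omega)
  have hlogN : Real.log ((q n : ℝ) ^ n) = n * Real.log (q n) := Real.log_pow _ _
  have hlogq : 1 / 2 ≤ Real.log (q n) := by
    have := Real.log_two_gt_d9
    have := Real.log_le_log two_pos hq'
    linarith
  have hlogq' : Real.log (q n) ≤ n := (Real.log_le_self (by linarith)).trans (hn1.trans hn2)
  have hloglog : 0 < Real.log (Real.log ((q n : ℝ) ^ n)) := by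
    rw [hlogN]
    exact Real.log_pos (by nlinarith)
  -- Since `log q ≤ q ≤ n`, `log N = n log q ≤ n²`.
  have hloglog' : Real.log (Real.log ((q n : ℝ) ^ n)) ≤ 2 * Real.log n := by
    have h : (2 : ℝ) * Real.log n = Real.log ((n : ℝ) ^ 2) := by rw [Real.log_pow]; norm_num
    rw [h, hlogN]
    exact Real.log_le_log (by nlinarith) (by nlinarith)
  -- The crude `exp (-t) ≤ 1 / t` suffices: it saves a factor of order `n / (log n)²`, while only
  -- `log log N ≤ 2 log n` is needed.
  have hexp : Real.exp (-(2 * n * τ ^ 2 / (q n : ℝ) ^ 2)) ≤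
      (A * Real.log n) ^ 2 / (2 * n * τ ^ 2) := by
    have hx : 0 < 2 * n * τ ^ 2 / (q n : ℝ) ^ 2 := by positivity
    rw [Real.exp_neg]
    calc (Real.exp (2 * n * τ ^ 2 / (q n : ℝ) ^ 2))⁻¹ ≤ (2 * n * τ ^ 2 / (q n : ℝ) ^ 2)⁻¹ :=
          inv_anti₀ hx (by linarith [Real.add_one_le_exp (2 * n * τ ^ 2 / (q n : ℝ) ^ 2)])
      _ = (q n : ℝ) ^ 2 / (2 * n * τ ^ 2) := inv_div _ _
      _ ≤ _ := by gcongr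
  have hrank : (maxMatrix (f n) + B).rank ≤
      ⌊C * (q n : ℝ) ^ n / Real.log (Real.log ((q n : ℝ) ^ n))⌋₊ := by
    refine Nat.le_floor (hB.trans ?_)
    rw [le_div_iff₀ hloglog]
    have h1 : 3 * ((A * Real.log n) ^ 2 / (2 * n * τ ^ 2)) * (2 * Real.log n) ≤ C := by
      have h2 : 3 * ((A * Real.log n) ^ 2 / (2 * n * τ ^ 2)) * (2 * Real.log n) =
          3 * A ^ 2 * Real.log n ^ 3 / (τ ^ 2 * n) := by
        field_simp
      rw [h2, div_le_iff₀ (by positivity)]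
      linarith
    calc 3 * ((q n : ℝ) ^ n * Real.exp (-(2 * n * τ ^ 2 / (q n : ℝ) ^ 2))) *
          Real.log (Real.log ((q n : ℝ) ^ n))
        ≤ 3 * ((q n : ℝ) ^ n * ((A * Real.log n) ^ 2 / (2 * n * τ ^ 2))) * (2 * Real.log n) := by
          gcongr
      _ = (q n : ℝ) ^ n * (3 * ((A * Real.log n) ^ 2 / (2 * n * τ ^ 2)) * (2 * Real.log n)) := by
          ring
      _ ≤ (q n : ℝ) ^ n * C := by gcongr
      _ = C * (q n : ℝ) ^ n := mul_comm _ _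
  have hrow : (B.nnzRow : ℝ) ≤ ((q n : ℝ) ^ n) ^ ε' := (le_max_left _ _).trans hB'
  have hnnz : (B.nnz : ℝ) ≤ (q n : ℝ) ^ n * B.nnzRow := by
    rw [← hcard]
    exact_mod_cast B.nnz_le_card_mul_nnzRow
  calc ((maxMatrix (f n)).rigidity
          ⌊C * (q n : ℝ) ^ n / Real.log (Real.log ((q n : ℝ) ^ n))⌋₊ : ℝ)
      ≤ B.nnz := by exact_mod_cast Matrix.rigidity_le hrank
    _ ≤ (q n : ℝ) ^ n * ((q n : ℝ) ^ n) ^ ε' := hnnz.trans (by gcongr)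
    _ < (q n : ℝ) ^ n * ((q n : ℝ) ^ n) ^ ε := by
        have := Real.rpow_lt_rpow_of_exponent_lt hN hε2
        gcongr
    _ = ((q n : ℝ) ^ n) ^ (1 + ε) := by
        rw [Real.rpow_add (by linarith), Real.rpow_one]

theorem theorem7p2 :
    (∃ c > (0 : ℝ), ∃ ε₀ > (0 : ℝ), ∃ K : ℝ,
      ∀ q : ℕ, 2 ≤ q → ∀ ε : ℝ, 0 < ε → ε < ε₀ →
      ∀ γ : ℝ, γ = c * ((q : ℝ) * Real.log q / 2 ^ q * (ε ^ 2 / Real.log (1 / ε) ^ 2)) →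
      ∀ n : ℕ, K ≤ ((q : ℝ) ^ n) ^ γ →
      ∀ (F : Type u) [Field F] (f : (Fin n → Fin q) → F),
        ((maxMatrix f).rcRigidity ⌊((q : ℝ) ^ n) ^ (1 - γ)⌋₊ : ℝ) ≤ ((q : ℝ) ^ n) ^ ε) ∧
    (∀ (F : Type u) [Field F] (q : ℕ → ℕ), (∀ n, 2 ≤ q n) →
      (fun n => (q n : ℝ)) =O[Filter.atTop] (fun n : ℕ => Real.log n) →
      ∀ f : ∀ n, (Fin n → Fin (q n)) → F,
        ¬ IsValiantRigid fun n => maxMatrix (f n)) :=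
  ⟨⟨1 / (1024 * 3840), by norm_num, 1 / 16, by norm_num, 3,
      fun _ hq _ hε hε' _ hγ _ hn _ _ f => rcRigidity_maxMatrix_le hq hε hε' hγ hn f⟩,
    fun _ _ _ hq hO f => not_isValiantRigid_maxMatrix hq hO f⟩
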